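/- Let $d\ge 1$, let $\mathbb{S}^{d}$ be the unit sphere of $\mathbb{R}^{d+1}$ with its (unnormalized) surface measure $\sigma$, and for $r>0$ let $S^{d}_{r}=r\,\mathbb{S}^{d}$ carry its surface measure, so that $\int_{S^{d}_{r}}f\,d\sigma=r^{d}\int_{\mathbb{S}^{d}}f(r\omega)\,d\sigma(\omega)$. For $\ell\ge 0$ let $\mathcal{H}_{\ell}$ be the space of restrictions to $\mathbb{S}^{d}$ of the homogeneous harmonic polynomials of degree $\ell$ on $\mathbb{R}^{d+1}$ with complex coefficients, and let $\Pi_{L}$ be the linear span of $\mathcal{H}_{0}\cup\dots\cup\mathcal{H}_{L}$. A function $Q\in\Pi_{L}$ is extended to a harmonic polynomial on $\mathbb{R}^{d+1}$, again denoted $Q$, by extending each component of $Q$ in $\mathcal{H}_{\ell}$ to the homogeneous harmonic polynomial of degree $\ell$ of which it is the restriction. Let $p\in[1,\infty]$ and $\rho>0$. There is a constant $C>0$, depending only on $d$, $p$ and $\rho$, such that for every integer $L\ge 1$, every $Q\in\Pi_{L}$ and every $r>0$ with $|r-1|\le\rho/L$ $$\|Q\|_{L^{p}(S^{d}_{r})}\le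 C^{-1}\|Q\|_{L^{p}(\mathbb{S}^{d})},$$ and, if moreover $\rho<L$ or $r\ge 1$, $$C\,\|Q\|_{L^{p}(\mathbb{S}^{d})}\le\|Q\|_{L^{p}(S^{d}_{r})}.$$ In particular, both inequalities hold whenever $L>\rho$ and $|r-1|\le\rho/L$. -/

import Mathlib

open scoped ENNReal

noncomputable section

namespace SphHarm

/-- The Euclidean space `ℝ^(d+1)` that contains the sphere `S^d`. -/
abbrev Ambient (d : ℕ) : Type := EuclideanSpace ℝ (Fin (d + 1))

/-- The unit sphere `S^d` of `ℝ^(d+1)`. -/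
abbrev Sph (d : ℕ) : Type := Metric.sphere (0 : Ambient d) 1

/-- The Laplacian of a polynomial in `d+1` variables with complex coefficients. -/
def polyLaplacian (d : ℕ) :
    MvPolynomial (Fin (d + 1)) ℂ →ₗ[ℂ] MvPolynomial (Fin (d + 1)) ℂ :=
  ∑ i : Fin (d + 1),
    (MvPolynomial.pderiv i).toLinearMap.comp (MvPolynomial.pderiv i).toLinearMap

/-- The homogeneous harmonic polynomials of degree `l` on `ℝ^(d+1)` (together with `0`). -/
def solidHarmonics (d l : ℕ) : Submodule ℂ (MvPolynomial (Fin (d + 1)) ℂ) :=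
  MvPolynomial.homogeneousSubmodule (Fin (d + 1)) ℂ l ⊓ LinearMap.ker (polyLaplacian d)

/-- The function on `ℝ^(d+1)` that a polynomial with complex coefficients defines. -/
def evalReal {d : ℕ} (P : MvPolynomial (Fin (d + 1)) ℂ) (x : Ambient d) : ℂ :=
  MvPolynomial.eval (fun i => (x i : ℂ)) P

/-- Restriction of a polynomial to the unit sphere. -/
def restrictSphere (d : ℕ) : MvPolynomial (Fin (d + 1)) ℂ →ₗ[ℂ] (Sph d → ℂ) where
  toFun P := fun ω => evalReal P (ω : Ambient d)
  map_add' P R := by ext ω; simp [evalReal]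
  map_smul' c P := by ext ω; simp [evalReal, MvPolynomial.smul_eval]

/-- `H_l`: the spherical harmonics of degree `l` on `S^d`, that is the restrictions to `S^d` of
the homogeneous harmonic polynomials of degree `l`. -/
def sphericalHarmonics (d l : ℕ) : Submodule ℂ (Sph d → ℂ) :=
  (solidHarmonics d l).map (restrictSphere d)

/-- `Π_L`: the spherical harmonics on `S^d` of degree not exceeding `L`, that is the linear span of
`H_0, …, H_L`. -/
def sphericalHarmonicsUpTo (d L : ℕ) : Submodule ℂ (Sph d → ℂ) :=
  ⨆ l ∈ Finset.range (L + 1), sphericalHarmonics d l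

/-- The harmonic polynomials on `ℝ^(d+1)` that are sums of homogeneous harmonic polynomials of
degrees `0, …, L`. -/
def solidHarmonicsUpTo (d L : ℕ) : Submodule ℂ (MvPolynomial (Fin (d + 1)) ℂ) :=
  ⨆ l ∈ Finset.range (L + 1), solidHarmonics d l

/-- `P` is the harmonic extension to `ℝ^(d+1)` of the function `Q ∈ Π_L`: if `Q` is the sum of
`Y_l ∈ H_l` for `l ≤ L`, then `P` is the sum of the homogeneous harmonic polynomials of degree `l`
that restrict to `Y_l`. -/
def IsHarmonicExtension {d : ℕ} (L : ℕ) (Q : Sph d → ℂ) (P : MvPolynomial (Fin (d + 1)) ℂ) :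
    Prop :=
  P ∈ solidHarmonicsUpTo d L ∧ restrictSphere d P = Q

/-- Every element of `Π_L` has a harmonic extension. -/
theorem exists_isHarmonicExtension {d L : ℕ} {Q : Sph d → ℂ}
    (hQ : Q ∈ sphericalHarmonicsUpTo d L) : ∃ P, IsHarmonicExtension L Q P := by
  have h : sphericalHarmonicsUpTo d L = (solidHarmonicsUpTo d L).map (restrictSphere d) := by
    simp only [sphericalHarmonicsUpTo, solidHarmonicsUpTo, sphericalHarmonics, Submodule.map_iSup]
  rw [h] at hQ
  obtain ⟨P, hP, rfl⟩ := hQ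
  exact ⟨P, hP, rfl⟩

/-- The Lebesgue surface measure `σ` on the unit sphere `S^d` (not normalized). -/
def surfaceMeasure (d : ℕ) : MeasureTheory.Measure (Sph d) :=
  (MeasureTheory.volume : MeasureTheory.Measure (Ambient d)).toSphere

/-- The surface measure on the sphere `S^d_r = r S^d`, as a measure on `ℝ^(d+1)`: the integral of
`f` over `S^d_r` is `r ^ d` times the integral of `f (r ω)` over the unit sphere. -/
def surfaceMeasureRadius (d : ℕ) (r : ℝ) : MeasureTheory.Measure (Ambient d) :=
  ENNReal.ofReal (r ^ d) •
    (surfaceMeasure d).map (fun ω : Sph d => r • (ω : Ambient d))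

/-- The norm of `L^p(S^d)`. -/
def normSphere {d : ℕ} (p : ℝ≥0∞) (f : Sph d → ℂ) : ℝ≥0∞ :=
  MeasureTheory.eLpNorm f p (surfaceMeasure d)

/-- The norm of `L^p(S^d_r)` of (the restriction to `S^d_r` of) a function on `ℝ^(d+1)`. -/
def normSphereRadius {d : ℕ} (p : ℝ≥0∞) (r : ℝ) (f : Ambient d → ℂ) : ℝ≥0∞ :=
  MeasureTheory.eLpNorm f p (surfaceMeasureRadius d r)

end SphHarm

end

noncomputable section

namespace SphHarm

/-! ### One-parameter groups of isometries: Bernstein's inequality and dissipativity -/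

section Abstract

/-! On the sphere of radius `r` the harmonic extension of `∑ Y_l` is the dilate `∑ r ^ l Y_l` on the
unit sphere, up to the Jacobian factor `r ^ (d / p)`. It remains to bound this multiplier on
`L^p(S^d)` uniformly in `L`. Only the rotation invariance of the norm is used, so all `p`, including
`∞`, are treated alike.

Let `D_jk` be the infinitesimal rotations and `A` the operator with eigenvalues `l (l + c)`, `c = d
- 1`. Then `-2 A` is the sum of `D_jk ^ 2` over ordered pairs. Under rotations in one coordinate
plane a polynomial of degree at most `L` is a trigonometric polynomial of degree at most `L`. This
gives two facts: Bernstein's inequality `‖D_jk ^ 2 P‖ ≤ L ^ 2 ‖P‖`, hence `‖A P‖ ≤ ((d + 1) L) ^ 2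
‖P‖` (`norm_lapEig_le`), and `Re g (D_jk ^ 2 P) ≤ 0` for every norming functional `g` of `P`, hence
`Re g (A P) ≥ 0` (`re_apply_lapEig_nonneg`).

For `r = e ^ t ≤ 1` the dilate `v t` solves `v'' + c v' = A v`, and a maximum principle based on the
second fact gives contraction (`norm_multSum_exp_le`). For `r > 1` the growing exponential is a cosh
minus a decaying exponential; the cosh is a power series in `A + c ^ 2 / 4`, controlled by Bernstein
(`norm_multSum_exp_le_cosh`). The lower bound is the upper bound for `1 / r` applied to the dilate.
-/

theorem second_deriv_nonpos_of_isLocalMax {f f' : ℝ → ℝ} {a c : ℝ} (h : IsLocalMax f a)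
    (hf : ∀ x, HasDerivAt f (f' x) x) (hf' : HasDerivAt f' c a) : c ≤ 0 := by
  by_contra! hc
  have hd : deriv f = f' := funext fun x => (hf x).deriv
  -- A positive second derivative would make `a` a local minimum as well, so that `f` is constant
  -- near `a` and its second derivative vanishes there.
  have hmin : IsLocalMin f a := by
    apply isLocalMin_of_deriv_deriv_pos
    · rwa [hd, hf'.deriv]
    · exact h.deriv_eq_zero
    · exact (hf a).continuousAt
  have hconst : f =ᶠ[nhds a] fun _ => f a := by
    filter_upwards [h, hmin] with x h1 h2 using le_antisymm h1 h2
  have h0 : f' =ᶠ[nhds a] fun _ => 0 := by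
    rw [← hd]
    simpa using hconst.deriv
  have := h0.deriv_eq
  rw [hf'.deriv, deriv_const] at this
  exact hc.ne' this

/-- The Fourier series of the Bernoulli polynomial `B_2` at `(m / L + 1) / 2`, which lies in `[0,
1]` because `|m| ≤ L`. It writes the multiplier `m ^ 2` as an absolutely convergent combination of
translations. The term `k = 0` is zero, since `1 / 0 = 0`. -/
theorem hasSum_sq_cos {L : ℕ} (hL : 1 ≤ L) {m : ℤ} (hm : |m| ≤ L) :
    HasSum (fun k : ℕ => 1 / (k : ℝ) ^ 2 * Real.cos (m * (Real.pi * k / L) + Real.pi * k))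
      (Real.pi ^ 2 / 4 * (m ^ 2 / (L : ℝ) ^ 2 - 1 / 3)) := by
  have hL' : (0 : ℝ) < L := by exact_mod_cast hL
  have hm' : |(m : ℝ)| ≤ L := by exact_mod_cast hm
  rw [abs_le] at hm'
  have hx : ((m : ℝ) / L + 1) / 2 ∈ Set.Icc (0 : ℝ) 1 := by
    have h1 : -1 ≤ (m : ℝ) / L := by rw [le_div_iff₀ hL']; linarith
    have h2 : (m : ℝ) / L ≤ 1 := by rw [div_le_iff₀ hL']; linarith
    constructor <;> linarith
  convert hasSum_one_div_nat_pow_mul_cos one_ne_zero hx using 1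
  · ext k
    congr 2
    field_simp
  · have : (Polynomial.bernoulli (2 * 1)) = Polynomial.X ^ 2 - Polynomial.X +
        Polynomial.C (1 / 6 : ℚ) := by
      simp [Polynomial.bernoulli, Finset.sum_range_succ, bernoulli_two, bernoulli_one,
        Polynomial.X_pow_eq_monomial, Polynomial.monomial_one_one_eq_X, sub_eq_add_neg]
    rw [this]
    simp
    field_simp
    ring

variable {E : Type*} [NormedAddCommGroup E] [NormedSpace ℂ E]

/-- The `E`-valued trigonometric sum with coefficients `w`. -/
def trigSum (s : Finset ℤ) (w : ℤ → E) (θ : ℝ) : E :=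
  ∑ m ∈ s, Complex.exp (Complex.I * m * θ) • w m

/-- The cosine multiplier is the mean of the translations by `α` and `-α`, with unimodular factors.
-/
theorem norm_sum_cos_smul_le {s : Finset ℤ} {w : ℤ → E}
    (hw : ∀ θ, ‖trigSum s w θ‖ = ‖∑ m ∈ s, w m‖) (α β : ℝ) :
    ‖∑ m ∈ s, (Real.cos (m * α + β) : ℂ) • w m‖ ≤ ‖∑ m ∈ s, w m‖ := by
  have h : ∑ m ∈ s, (Real.cos (m * α + β) : ℂ) • w m =
      (Complex.exp (β * Complex.I) / 2) • trigSum s w α +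
      (Complex.exp ((-β : ℝ) * Complex.I) / 2) • trigSum s w (-α) := by
    simp only [trigSum, Finset.smul_sum, ← Finset.sum_add_distrib, smul_smul, ← add_smul]
    refine Finset.sum_congr rfl fun m _ => ?_
    congr 1
    rw [Complex.ofReal_cos, Complex.cos]
    push_cast
    rw [div_mul_eq_mul_div, div_mul_eq_mul_div, ← Complex.exp_add, ← Complex.exp_add, ← add_div]
    congr 3 <;> ring
  rw [h]
  refine (norm_add_le _ _).trans ?_
  rw [norm_smul, norm_smul, norm_div, norm_div, Complex.norm_exp_ofReal_mul_I,
    Complex.norm_exp_ofReal_mul_I, hw, hw]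
  norm_num
  linarith

/-- Bernstein's inequality for the second derivative. -/
theorem norm_sum_sq_smul_le {L : ℕ} (hL : 1 ≤ L) {s : Finset ℤ} (hs : ∀ m ∈ s, |m| ≤ L)
    {w : ℤ → E} (hw : ∀ θ, ‖trigSum s w θ‖ = ‖∑ m ∈ s, w m‖) :
    ‖∑ m ∈ s, (m : ℂ) ^ 2 • w m‖ ≤ (L : ℝ) ^ 2 * ‖∑ m ∈ s, w m‖ := by
  have hL' : (0 : ℝ) < L := by exact_mod_cast hL
  set S := ∑ m ∈ s, w m with hS
  set T := ∑ m ∈ s, ((Real.pi ^ 2 / 4 * (m ^ 2 / (L : ℝ) ^ 2 - 1 / 3) : ℝ) : ℂ) • w m with hT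
  have hsum : HasSum (fun k : ℕ => ∑ m ∈ s, ((1 / (k : ℝ) ^ 2 *
      Real.cos (m * (Real.pi * k / L) + Real.pi * k) : ℝ) : ℂ) • w m) T :=
    hasSum_sum fun m hm =>
      (Complex.hasSum_ofReal.mpr (hasSum_sq_cos hL (hs m hm))).smul_const (w m)
  have hTn : ‖T‖ ≤ Real.pi ^ 2 / 6 * ‖S‖ := by
    rw [← hsum.tsum_eq]
    refine tsum_of_norm_bounded (hasSum_zeta_two.mul_right ‖S‖) fun k => ?_
    have : ∑ m ∈ s, ((1 / (k : ℝ) ^ 2 *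
        Real.cos (m * (Real.pi * k / L) + Real.pi * k) : ℝ) : ℂ) • w m =
        ((1 / (k : ℝ) ^ 2 : ℝ) : ℂ) • ∑ m ∈ s,
          (Real.cos (m * (Real.pi * k / L) + Real.pi * k) : ℂ) • w m := by
      simp only [Finset.smul_sum, smul_smul, Complex.ofReal_mul]
    rw [this, norm_smul, Complex.norm_of_nonneg (by positivity)]
    gcongr
    exact norm_sum_cos_smul_le hw _ _
  -- Solving the cosine series for `m ^ 2`. The norms add up to exactly `L ^ 2 / 3 + (4 L ^ 2 / π ^
  -- 2) (π ^ 2 / 6) = L ^ 2`.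
  have hid : ∑ m ∈ s, (m : ℂ) ^ 2 • w m =
      (((L : ℝ) ^ 2 / 3 : ℝ) : ℂ) • S + ((4 * (L : ℝ) ^ 2 / Real.pi ^ 2 : ℝ) : ℂ) • T := by
    simp only [hS, hT, Finset.smul_sum, smul_smul, ← Finset.sum_add_distrib, ← add_smul]
    refine Finset.sum_congr rfl fun m _ => ?_
    congr 1
    rw [← Complex.ofReal_mul, ← Complex.ofReal_add]
    have : (m : ℂ) ^ 2 = (((m : ℝ) ^ 2 : ℝ) : ℂ) := by push_cast; rfl
    rw [this]
    congr 1
    have := Real.pi_ne_zero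
    field_simp
    ring
  rw [hid]
  refine (norm_add_le _ _).trans ?_
  rw [norm_smul, norm_smul, Complex.norm_of_nonneg (by positivity),
    Complex.norm_of_nonneg (by positivity)]
  calc _ ≤ (L : ℝ) ^ 2 / 3 * ‖S‖ + 4 * (L : ℝ) ^ 2 / Real.pi ^ 2 * (Real.pi ^ 2 / 6 * ‖S‖) := by
        gcongr
    _ = _ := by
        have := Real.pi_ne_zero
        field_simp
        ring

theorem hasDerivAt_re_sum_exp {ι : Type*} (s : Finset ι) (a z : ι → ℂ) (x : ℝ) :
    HasDerivAt (fun t : ℝ => (∑ i ∈ s, Complex.exp (a i * t) * z i).re)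
      (∑ i ∈ s, Complex.exp (a i * x) * (a i * z i)).re x := by
  have h : HasDerivAt (fun t : ℂ => ∑ i ∈ s, Complex.exp (a i * t) * z i)
      (∑ i ∈ s, Complex.exp (a i * x) * (a i * z i)) (x : ℂ) := by
    refine HasDerivAt.fun_sum fun i _ => ?_
    have := (((hasDerivAt_id' (x : ℂ)).const_mul (a i)).cexp).mul_const (z i)
    exact this.congr_deriv (by ring)
  exact h.real_of_complex

theorem re_apply_le_norm {g : StrongDual ℂ E} (hg : ‖g‖ ≤ 1) (x : E) : (g x).re ≤ ‖x‖ :=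
  (Complex.re_le_norm _).trans ((g.le_opNorm x).trans
    (mul_le_of_le_one_left (norm_nonneg _) hg))

/-- Along the orbit the norm is constant, so the real part of a norming functional is largest at `θ
= 0`; its second derivative there is minus the quantity in question. -/
theorem re_apply_sum_sq_smul_nonneg {s : Finset ℤ} {w : ℤ → E}
    (hw : ∀ θ, ‖trigSum s w θ‖ = ‖∑ m ∈ s, w m‖) {g : StrongDual ℂ E} (hg : ‖g‖ ≤ 1)
    (hgS : g (∑ m ∈ s, w m) = ‖∑ m ∈ s, w m‖) : 0 ≤ (g (∑ m ∈ s, (m : ℂ) ^ 2 • w m)).re := by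
  have h1 := hasDerivAt_re_sum_exp s (fun m : ℤ => Complex.I * m) (fun m => g (w m))
  have h2 := hasDerivAt_re_sum_exp s (fun m : ℤ => Complex.I * m)
    (fun m => Complex.I * m * g (w m)) 0
  have hmax : IsLocalMax
      (fun t : ℝ => (∑ m ∈ s, Complex.exp (Complex.I * m * t) * g (w m)).re) 0 := by
    refine Filter.Eventually.of_forall fun t => ?_
    have e1 : ∑ m ∈ s, Complex.exp (Complex.I * m * t) * g (w m) = g (trigSum s w t) := by
      simp [trigSum]
    have e2 : ∑ m ∈ s, Complex.exp (Complex.I * m * (0 : ℝ)) * g (w m) = g (∑ m ∈ s, w m) := by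
      simp
    simp only [e1, e2]
    rw [hgS, Complex.ofReal_re, ← hw t]
    exact re_apply_le_norm hg _
  have h := second_deriv_nonpos_of_isLocalMax hmax h1 h2
  have e : ∑ m ∈ s, Complex.exp (Complex.I * m * (0 : ℝ)) *
      (Complex.I * m * (Complex.I * m * g (w m))) = -g (∑ m ∈ s, (m : ℂ) ^ 2 • w m) := by
    simp only [map_sum, map_smul, smul_eq_mul, ← Finset.sum_neg_distrib]
    refine Finset.sum_congr rfl fun m _ => ?_
    simp only [Complex.ofReal_zero, mul_zero, Complex.exp_zero, one_mul]
    linear_combination (m : ℂ) ^ 2 * g (w m) * Complex.I_sq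
  rw [e, Complex.neg_re] at h
  linarith

end Abstract

/-! ### Multipliers `e ^ (l t)` for an operator with eigenvalues `l (l + c)` -/

section Multipliers

variable {E : Type*} [NormedAddCommGroup E] [NormedSpace ℂ E]

/-- The combination of the vectors `Y l` with real coefficients `a l`. -/
def multSum (s : Finset ℕ) (Y : ℕ → E) (a : ℕ → ℝ) : E := ∑ l ∈ s, (a l : ℂ) • Y l

/-- The eigenvalues `l (l + c)` of the Laplace-Beltrami operator, up to sign. -/
def lapEig (c : ℝ) (l : ℕ) : ℝ := l * (l + c)

theorem multSum_mul_left (s : Finset ℕ) (Y : ℕ → E) (x : ℝ) (a : ℕ → ℝ) :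
    multSum s Y (fun l => x * a l) = (x : ℂ) • multSum s Y a := by
  simp only [multSum, Finset.smul_sum, smul_smul, Complex.ofReal_mul]

theorem multSum_add (s : Finset ℕ) (Y : ℕ → E) (a b : ℕ → ℝ) :
    multSum s Y (fun l => a l + b l) = multSum s Y a + multSum s Y b := by
  simp [multSum, add_smul, Finset.sum_add_distrib]

theorem multSum_sub (s : Finset ℕ) (Y : ℕ → E) (a b : ℕ → ℝ) :
    multSum s Y (fun l => a l - b l) = multSum s Y a - multSum s Y b := by
  simp [multSum, sub_smul, Finset.sum_sub_distrib]

theorem norm_real_smul (x : ℝ) (v : E) : ‖(x : ℂ) • v‖ = |x| * ‖v‖ := by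
  rw [norm_smul, Complex.norm_real, Real.norm_eq_abs]

/-- The Poisson semigroup is contractive, for any norm in which the Laplace-Beltrami operator is
dissipative. -/
theorem norm_multSum_exp_le {s : Finset ℕ} {Y : ℕ → E} {c : ℝ} (hc : 0 ≤ c)
    (hA : ∀ (a : ℕ → ℝ) (g : StrongDual ℂ E), ‖g‖ ≤ 1 → g (multSum s Y a) = ‖multSum s Y a‖ →
      0 ≤ (g (multSum s Y fun l => lapEig c l * a l)).re)
    {t : ℝ} (ht : t ≤ 0) :
    ‖multSum s Y fun l => Real.exp (l * t)‖ ≤ ‖multSum s Y fun _ => 1‖ := by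
  rcases ht.eq_or_lt with rfl | ht
  · simp
  by_contra! hlt
  set v : ℝ → E := fun t => multSum s Y fun l => Real.exp (l * t) with hv
  have hvcont : Continuous v := by
    simp only [hv, multSum]
    fun_prop
  have hv0 : multSum s Y (fun _ => 1) = v 0 := by simp [hv]
  rw [hv0] at hlt
  change ‖v 0‖ < ‖v t‖ at hlt
  set B := ∑ l ∈ s, ‖Y l‖ with hB
  have hvB : ∀ x ≤ 0, ‖v x‖ ≤ B := fun x hx => by
    refine (norm_sum_le _ _).trans (Finset.sum_le_sum fun l _ => ?_)
    rw [norm_real_smul, abs_of_pos (Real.exp_pos _)]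
    refine mul_le_of_le_one_left (norm_nonneg _) (Real.exp_le_one_iff.mpr ?_)
    exact mul_nonpos_of_nonneg_of_nonpos (by positivity) hx
  -- `ε (1 - t)` is half of the supposed gap `‖v t‖ - ‖v 0‖`.
  obtain ⟨ε, hε, hεt⟩ : ∃ ε > 0, ‖v 0‖ + ε < ‖v t‖ + ε * t := by
    refine ⟨(‖v t‖ - ‖v 0‖) / (2 * (1 - t)), div_pos (by linarith) (by linarith), ?_⟩
    have h : (‖v t‖ - ‖v 0‖) / (2 * (1 - t)) * (1 - t) = (‖v t‖ - ‖v 0‖) / 2 := by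
      have : (1 - t) ≠ 0 := by linarith
      field_simp
    linarith
  -- The barrier `h = x + e ^ (2 x)` satisfies `h'' + c h' > 0`, even for `c = 0`, and tends to `-∞`
  -- on the left. The maximum of `f` on a long interval `[a, 0]` is therefore interior.
  set f : ℝ → ℝ := fun x => ‖v x‖ + ε * (x + Real.exp (2 * x)) with hf
  have hfcont : Continuous f := by
    simp only [hf]
    fun_prop
  have hf0 : f 0 < f t := by
    have := mul_pos hε (Real.exp_pos (2 * t))
    simp only [hf, mul_zero, Real.exp_zero, zero_add, mul_one]
    linarith
  obtain ⟨a, hat, hfa⟩ : ∃ a < t, f a < f t := by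
    refine ⟨min (t - 1) (-1 - B / ε), (min_le_left _ _).trans_lt (by linarith), ?_⟩
    set a := min (t - 1) (-1 - B / ε)
    have ha1 : a ≤ t - 1 := min_le_left _ _
    have ha2 : a ≤ -1 - B / ε := min_le_right _ _
    have h1 := hvB a (by linarith)
    have h2 : ε * a ≤ -ε - B := by
      calc ε * a ≤ ε * (-1 - B / ε) := by gcongr
        _ = _ := by field_simp
    have h3 : Real.exp (2 * a) ≤ 1 := Real.exp_le_one_iff.mpr (by linarith)
    have h4 := mul_le_mul_of_nonneg_left h3 hε.le
    have h5 := norm_nonneg (v 0)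
    have : f a ≤ 0 := by simp only [hf]; linarith
    have h6 : 0 ≤ f 0 := by
      simp only [hf]
      simp
      positivity
    linarith
  obtain ⟨x, hx, hxmax⟩ := isCompact_Icc.exists_isMaxOn
    (Set.nonempty_Icc.mpr (hat.le.trans ht.le)) hfcont.continuousOn (s := Set.Icc a 0)
  have hxt : f t ≤ f x := hxmax ⟨hat.le, ht.le⟩
  have hxa : a < x := hx.1.lt_of_ne (by rintro rfl; linarith)
  have hx0 : x < 0 := hx.2.lt_of_ne (by rintro rfl; linarith)
  obtain ⟨g, hg, hgv⟩ := exists_dual_vector'' ℂ (v x)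
  -- A smooth minorant of `f` that touches it at `x`, so it too has a local maximum there, although
  -- the norm need not be differentiable.
  set φ : ℝ → ℝ := fun y => (∑ l ∈ s, Complex.exp ((l : ℂ) * y) * g (Y l)).re +
    ε * (y + Real.exp (2 * y)) with hφ
  have hgsum : ∀ y, g (v y) = ∑ l ∈ s, Complex.exp ((l : ℂ) * y) * g (Y l) := fun y => by
    simp [hv, multSum]
  have hmax : IsLocalMax φ x := by
    filter_upwards [Icc_mem_nhds hxa hx0] with y hy
    have h1 := hxmax hy
    have h2 := re_apply_le_norm hg (v y)
    simp only [hφ, ← hgsum, hgv]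
    simp only [hf, Set.mem_ofPred_eq] at h1
    simp only [Complex.coe_algebraMap, Complex.ofReal_re]
    linarith
  have hd2 : ∀ y : ℝ, HasDerivAt (fun y : ℝ => Real.exp (2 * y)) (2 * Real.exp (2 * y)) y := fun y =>
    (((hasDerivAt_id' y).const_mul 2).exp).congr_deriv (by ring)
  have h1 : ∀ y : ℝ, HasDerivAt φ ((∑ l ∈ s, Complex.exp ((l : ℂ) * y) * (l * g (Y l))).re +
      ε * (1 + 2 * Real.exp (2 * y))) y := fun y =>
    (hasDerivAt_re_sum_exp s (fun l : ℕ => (l : ℂ)) _ y).add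
      (((hasDerivAt_id' y).add (hd2 y)).const_mul ε)
  have h2 : HasDerivAt (fun y : ℝ => (∑ l ∈ s, Complex.exp ((l : ℂ) * y) * (l * g (Y l))).re +
      ε * (1 + 2 * Real.exp (2 * y)))
      ((∑ l ∈ s, Complex.exp ((l : ℂ) * x) * (l * (l * g (Y l)))).re +
      ε * (2 * (2 * Real.exp (2 * x)))) x :=
    (hasDerivAt_re_sum_exp s (fun l : ℕ => (l : ℂ)) _ x).add
      ((((hd2 x).const_mul 2).const_add 1).const_mul ε)
  have hle := second_deriv_nonpos_of_isLocalMax hmax h1 h2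
  have heq := hmax.hasDerivAt_eq_zero (h1 x)
  have hpos := hA _ g hg hgv
  -- This is `A v = v'' + c v'` under `g`. With `φ' x = 0` and `φ'' x ≤ 0`, dissipativity
  -- contradicts the strict inequality for the barrier.
  have hAe : g (multSum s Y fun l => lapEig c l * Real.exp (l * x)) =
      (∑ l ∈ s, Complex.exp ((l : ℂ) * x) * (l * (l * g (Y l)))) +
      (c : ℂ) * (∑ l ∈ s, Complex.exp ((l : ℂ) * x) * (l * g (Y l))) := by
    simp only [multSum, map_sum, map_smul, smul_eq_mul, Finset.mul_sum, ← Finset.sum_add_distrib,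
      lapEig]
    refine Finset.sum_congr rfl fun l _ => ?_
    push_cast
    ring
  rw [hAe, Complex.add_re, Complex.re_ofReal_mul] at hpos
  have he := Real.exp_pos (2 * x)
  have := mul_nonneg hc (mul_nonneg hε.le (show 0 ≤ 1 + 2 * Real.exp (2 * x) by positivity))
  have h3 := mul_pos hε he
  have h4 := congrArg (c * ·) heq
  simp only [mul_add, mul_zero] at h4 this hle
  linarith

/-- Completing the square, `(l + c / 2) ^ 2 = l (l + c) + c ^ 2 / 4`, so even powers of `l + c / 2`
are powers of a bounded operator. This is why the next bound concerns cosh, an even function. -/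
theorem norm_multSum_pow_mul_le {s : Finset ℕ} {Y : ℕ → E} {c K : ℝ} (hK : 0 ≤ K)
    (hA : ∀ a : ℕ → ℝ, ‖multSum s Y fun l => lapEig c l * a l‖ ≤ K * ‖multSum s Y a‖) (k : ℕ) :
    ‖multSum s Y fun l => ((l : ℝ) + c / 2) ^ (2 * k)‖ ≤
      (K + c ^ 2 / 4) ^ k * ‖multSum s Y fun _ => 1‖ := by
  induction k with
  | zero => simp
  | succ k ih =>
    have e : (fun l : ℕ => ((l : ℝ) + c / 2) ^ (2 * (k + 1))) =
        fun l : ℕ => lapEig c l * ((l : ℝ) + c / 2) ^ (2 * k) +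
          c ^ 2 / 4 * ((l : ℝ) + c / 2) ^ (2 * k) := by
      ext l
      rw [lapEig]
      ring
    rw [e, multSum_add, multSum_mul_left]
    refine (norm_add_le _ _).trans ?_
    rw [norm_real_smul, abs_of_nonneg (by positivity)]
    refine (add_le_add_left (hA _) _).trans ?_
    rw [← add_mul, pow_succ' (K + _), mul_assoc]
    gcongr

theorem norm_multSum_cosh_le {s : Finset ℕ} {Y : ℕ → E} {c K : ℝ} (hK : 0 ≤ K)
    (hA : ∀ a : ℕ → ℝ, ‖multSum s Y fun l => lapEig c l * a l‖ ≤ K * ‖multSum s Y a‖) (τ : ℝ) :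
    ‖multSum s Y fun l => Real.cosh (τ * (l + c / 2))‖ ≤
      Real.cosh (τ * √(K + c ^ 2 / 4)) * ‖multSum s Y fun _ => 1‖ := by
  have hsum : HasSum (fun k : ℕ => multSum s Y fun l =>
      (τ * (l + c / 2)) ^ (2 * k) / (2 * k).factorial)
      (multSum s Y fun l => Real.cosh (τ * (l + c / 2))) :=
    hasSum_sum fun l _ => (Complex.hasSum_ofReal.mpr (Real.hasSum_cosh _)).smul_const (Y l)
  rw [← hsum.tsum_eq]
  refine tsum_of_norm_bounded ((Real.hasSum_cosh _).mul_right _) fun k => ?_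
  have e : (fun l : ℕ => (τ * ((l : ℝ) + c / 2)) ^ (2 * k) / ((2 * k).factorial : ℝ)) =
      fun l : ℕ => τ ^ (2 * k) / ((2 * k).factorial : ℝ) * ((l : ℝ) + c / 2) ^ (2 * k) := by
    ext l
    rw [mul_pow]
    ring
  have hτ : 0 ≤ τ ^ (2 * k) := by rw [pow_mul]; positivity
  rw [e, multSum_mul_left, norm_real_smul, abs_of_nonneg (by positivity), mul_pow,
    pow_mul (√_), Real.sq_sqrt (by positivity)]
  calc _ ≤ τ ^ (2 * k) / ((2 * k).factorial : ℝ) *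
        ((K + c ^ 2 / 4) ^ k * ‖multSum s Y fun _ => 1‖) := by
        gcongr
        exact norm_multSum_pow_mul_le hK hA k
    _ = _ := by ring

theorem norm_multSum_exp_le_cosh {s : Finset ℕ} {Y : ℕ → E} {c K : ℝ} (hc : 0 ≤ c) (hK : 0 ≤ K)
    (hA : ∀ (a : ℕ → ℝ) (g : StrongDual ℂ E), ‖g‖ ≤ 1 → g (multSum s Y a) = ‖multSum s Y a‖ →
      0 ≤ (g (multSum s Y fun l => lapEig c l * a l)).re)
    (hA' : ∀ a : ℕ → ℝ, ‖multSum s Y fun l => lapEig c l * a l‖ ≤ K * ‖multSum s Y a‖)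
    {τ : ℝ} (hτ : 0 ≤ τ) :
    ‖multSum s Y fun l => Real.exp (l * τ)‖ ≤
      (2 * Real.cosh (τ * √(K + c ^ 2 / 4)) + 1) * ‖multSum s Y fun _ => 1‖ := by
  set q := Real.exp (-(τ * (c / 2))) with hq
  have hq0 : 0 ≤ q := (Real.exp_pos _).le
  have hq1 : q ≤ 1 := Real.exp_le_one_iff.mpr (by have : 0 ≤ τ * (c / 2) := by positivity
                                                  linarith)
  -- From `e ^ x = 2 cosh x - e ^ (-x)` at `x = τ (l + c / 2)`, multiplied by `q = e ^ (-τ c / 2)`.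
  -- The last term is a contraction by the maximum principle.
  have e : (fun l : ℕ => Real.exp (l * τ)) = fun l : ℕ =>
      (2 * q) * Real.cosh (τ * (l + c / 2)) - q ^ 2 * Real.exp (l * -τ) := by
    ext l
    rw [Real.cosh_eq]
    have h1 : Real.exp (l * τ) = q * Real.exp (τ * (l + c / 2)) := by
      rw [hq, ← Real.exp_add]
      ring_nf
    have h2 : q * Real.exp (-(τ * (l + c / 2))) = q ^ 2 * Real.exp (l * -τ) := by
      rw [hq, ← Real.exp_add, ← Real.exp_nat_mul, ← Real.exp_add]
      congr 1
      push_cast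
      ring
    rw [h1, ← h2]
    ring
  rw [e, multSum_sub, multSum_mul_left, multSum_mul_left]
  refine (norm_sub_le _ _).trans ?_
  rw [norm_real_smul, norm_real_smul, abs_of_nonneg (by positivity), abs_of_nonneg (by positivity),
    add_mul]
  have h1 := norm_multSum_cosh_le hK hA' τ
  have h2 := norm_multSum_exp_le hc hA (neg_nonpos.mpr hτ)
  have h3 : q ^ 2 ≤ 1 := pow_le_one₀ hq0 hq1
  refine add_le_add ?_ (mul_le_mul h3 h2 (norm_nonneg _) zero_le_one)
  rw [mul_assoc 2 (Real.cosh _)]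
  exact mul_le_mul (by linarith) h1 (norm_nonneg _) zero_le_two

end Multipliers

/-! ### Weights of polynomials under plane rotations, and the sum of squares of infinitesimal
rotations -/

section Polynomials

open MvPolynomial

variable {σ : Type*}

/-- The infinitesimal rotation `x_j ∂_k - x_k ∂_j`. -/
def angDeriv (j k : σ) : Derivation ℂ (MvPolynomial σ ℂ) (MvPolynomial σ ℂ) :=
  (X j : MvPolynomial σ ℂ) • pderiv k - (X k : MvPolynomial σ ℂ) • pderiv j

theorem angDeriv_apply (j k : σ) (P : MvPolynomial σ ℂ) :
    angDeriv j k P = X j * pderiv k P - X k * pderiv j P := rfl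

variable [DecidableEq σ]

/-- The substitution by the rotation of angle `θ` in the plane of the coordinates `j` and `k`. -/
def rotHom (j k : σ) (θ : ℝ) : MvPolynomial σ ℂ →ₐ[ℂ] MvPolynomial σ ℂ :=
  aeval fun i => if i = j then C (Complex.cos θ) * X j - C (Complex.sin θ) * X k
    else if i = k then C (Complex.sin θ) * X j + C (Complex.cos θ) * X k else X i

/-- The polynomials of weight `m` under the rotations in the plane of the coordinates `j` and
`k`. -/
def weightSpace (j k : σ) (m : ℤ) : Submodule ℂ (MvPolynomial σ ℂ) where
  carrier := {P | angDeriv j k P = (Complex.I * m) • P ∧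
    ∀ θ : ℝ, rotHom j k θ P = Complex.exp (Complex.I * m * θ) • P}
  add_mem' := by
    rintro P R ⟨h1, h2⟩ ⟨h3, h4⟩
    exact ⟨by rw [map_add, h1, h3, smul_add], fun θ => by rw [map_add, h2, h4, smul_add]⟩
  zero_mem' := by simp
  smul_mem' := by
    rintro a P ⟨h1, h2⟩
    exact ⟨by rw [Derivation.map_smul, h1, smul_comm], fun θ => by rw [map_smul, h2, smul_comm]⟩

theorem mem_weightSpace {j k : σ} {m : ℤ} {P : MvPolynomial σ ℂ} :
    P ∈ weightSpace j k m ↔ angDeriv j k P = (Complex.I * m) • P ∧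
      ∀ θ : ℝ, rotHom j k θ P = Complex.exp (Complex.I * m * θ) • P := Iff.rfl

/-- The infinitesimal rotation is a derivation and the rotation an algebra homomorphism, so weights
add. -/
theorem mul_mem_weightSpace {j k : σ} {m n : ℤ} {P R : MvPolynomial σ ℂ}
    (hP : P ∈ weightSpace j k m) (hR : R ∈ weightSpace j k n) :
    P * R ∈ weightSpace j k (m + n) := by
  rw [mem_weightSpace] at *
  refine ⟨?_, fun θ => ?_⟩
  · rw [Derivation.leibniz, hP.1, hR.1]
    simp only [smul_eq_mul, smul_eq_C_mul, map_mul, map_intCast, Int.cast_add, map_add]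
    ring
  · rw [map_mul, hP.2, hR.2, smul_mul_smul_comm, ← Complex.exp_add]
    congr 2
    push_cast
    ring

theorem one_mem_weightSpace (j k : σ) : (1 : MvPolynomial σ ℂ) ∈ weightSpace j k 0 := by
  simp [mem_weightSpace]

theorem X_mem_weightSpace {i j k : σ} (hj : i ≠ j) (hk : i ≠ k) :
    (X i : MvPolynomial σ ℂ) ∈ weightSpace j k 0 := by
  simp [mem_weightSpace, angDeriv_apply, rotHom, hj, hk]

theorem X_add_mem_weightSpace {j k : σ} (h : j ≠ k) :
    (X j + C Complex.I * X k : MvPolynomial σ ℂ) ∈ weightSpace j k 1 := by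
  have hI : C Complex.I * C Complex.I = (-1 : MvPolynomial σ ℂ) := by
    rw [← C_mul, Complex.I_mul_I]; simp
  refine ⟨?_, fun θ => ?_⟩
  · simp only [angDeriv_apply, map_add, pderiv_X_of_ne h, pderiv_X_of_ne h.symm, pderiv_X_self,
      pderiv_C_mul, smul_eq_C_mul, Int.cast_one, mul_one]
    linear_combination (-X k) * hI
  · have e : Complex.exp (Complex.I * (1 : ℤ) * θ) =
        Complex.cos θ + Complex.sin θ * Complex.I := by
      rw [← Complex.exp_mul_I]; congr 1; push_cast; ring
    rw [e]
    simp only [rotHom, map_add, map_mul, aeval_X, aeval_C, algebraMap_eq, if_true, h.symm, if_false,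
      smul_eq_C_mul]
    linear_combination (-C (Complex.sin θ) * X k) * hI

theorem X_sub_mem_weightSpace {j k : σ} (h : j ≠ k) :
    (X j - C Complex.I * X k : MvPolynomial σ ℂ) ∈ weightSpace j k (-1) := by
  have hI : C Complex.I * C Complex.I = (-1 : MvPolynomial σ ℂ) := by
    rw [← C_mul, Complex.I_mul_I]; simp
  refine ⟨?_, fun θ => ?_⟩
  · simp only [angDeriv_apply, map_sub, pderiv_X_of_ne h, pderiv_X_of_ne h.symm, pderiv_X_self,
      pderiv_C_mul, smul_eq_C_mul, Int.cast_neg, Int.cast_one, mul_neg, mul_one, map_neg]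
    linear_combination (-X k) * hI
  · have e : Complex.exp (Complex.I * (-1 : ℤ) * θ) =
        Complex.cos θ - Complex.sin θ * Complex.I := by
      have := Complex.exp_mul_I (-θ)
      rw [Complex.cos_neg, Complex.sin_neg] at this
      rw [sub_eq_add_neg, ← neg_mul, ← this]; congr 1; push_cast; ring
    rw [e]
    simp only [rotHom, map_sub, map_mul, aeval_X, aeval_C, algebraMap_eq, if_true, h.symm, if_false,
      smul_eq_C_mul]
    linear_combination (-C (Complex.sin θ) * X k) * hI

/-- The sum of the weight spaces of weights in `[-n, n]`. -/
def weightSum (j k : σ) (n : ℕ) : Submodule ℂ (MvPolynomial σ ℂ) :=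
  ⨆ m ∈ Finset.Icc (-n : ℤ) n, weightSpace j k m

theorem weightSpace_le_weightSum {j k : σ} {m : ℤ} {n : ℕ} (h : |m| ≤ n) :
    weightSpace j k m ≤ weightSum j k n :=
  le_iSup₂_of_le m (Finset.mem_Icc.mpr (abs_le.mp h)) le_rfl

theorem weightSum_mono {j k : σ} {a b : ℕ} (h : a ≤ b) : weightSum j k a ≤ weightSum j k b :=
  iSup₂_le fun m hm => weightSpace_le_weightSum (by
    rw [Finset.mem_Icc] at hm
    rw [abs_le]
    omega)

theorem weightSum_mul_le (j k : σ) (a b : ℕ) :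
    weightSum j k a * weightSum j k b ≤ weightSum j k (a + b) := by
  simp only [weightSum, Submodule.iSup_mul, Submodule.mul_iSup]
  refine iSup₂_le fun m hm => iSup₂_le fun n hn => Submodule.mul_le.mpr fun P hP R hR => ?_
  refine weightSpace_le_weightSum ?_ (mul_mem_weightSpace hP hR)
  rw [Finset.mem_Icc] at hm hn
  rw [abs_le]
  push_cast
  omega

theorem X_mem_weightSum {j k : σ} (h : j ≠ k) (i : σ) :
    (X i : MvPolynomial σ ℂ) ∈ weightSum j k 1 := by
  have h1 := weightSpace_le_weightSum (n := 1) (by simp) (X_add_mem_weightSpace h)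
  have h2 := weightSpace_le_weightSum (n := 1) (by simp) (X_sub_mem_weightSpace h)
  rcases eq_or_ne i j with rfl | hj
  · convert Submodule.smul_mem _ (1 / 2 : ℂ) (Submodule.add_mem _ h1 h2) using 1
    have : C (1 / 2 : ℂ) * 2 = (1 : MvPolynomial σ ℂ) := by
      rw [show (2 : MvPolynomial σ ℂ) = C 2 from (map_ofNat C 2).symm, ← C_mul]; simp
    rw [smul_eq_C_mul]
    linear_combination (-X i) * this
  rcases eq_or_ne i k with rfl | hk
  · convert Submodule.smul_mem _ (-Complex.I / 2 : ℂ) (Submodule.sub_mem _ h1 h2) using 1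
    have : C (-Complex.I / 2) * 2 * C Complex.I = (1 : MvPolynomial σ ℂ) := by
      rw [show (2 : MvPolynomial σ ℂ) = C 2 from (map_ofNat C 2).symm, ← C_mul, ← C_mul]; simp
    rw [smul_eq_C_mul]
    linear_combination (-X i) * this
  · exact weightSpace_le_weightSum (by simp) (X_mem_weightSpace hj hk)

/-- Linear forms have weights in `{-1, 0, 1}`, by diagonalizing with `x_j ± i x_k`, and forms of
degree `n` are spanned by `n`-fold products of linear forms. -/
theorem homogeneousSubmodule_le_weightSum {j k : σ} (h : j ≠ k) (n : ℕ) :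
    homogeneousSubmodule σ ℂ n ≤ weightSum j k n := by
  rw [← homogeneousSubmodule_one_pow]
  induction n with
  | zero =>
    rw [pow_zero, Submodule.one_le]
    exact weightSpace_le_weightSum (by simp) (one_mem_weightSpace j k)
  | succ n ih =>
    rw [pow_succ]
    refine (mul_le_mul' ih ?_).trans (weightSum_mul_le j k n 1)
    rw [homogeneousSubmodule_one_eq_span_X, Submodule.span_le]
    rintro _ ⟨i, rfl⟩
    exact X_mem_weightSum h i

theorem exists_weight_decomposition {j k : σ} {n : ℕ} {P : MvPolynomial σ ℂ}
    (hP : P ∈ weightSum j k n) : ∃ w : ℤ → MvPolynomial σ ℂ,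
      ∑ m ∈ Finset.Icc (-n : ℤ) n, w m = P ∧
      (∀ θ : ℝ, rotHom j k θ P =
        ∑ m ∈ Finset.Icc (-n : ℤ) n, Complex.exp (Complex.I * m * θ) • w m) ∧
      angDeriv j k (angDeriv j k P) = -∑ m ∈ Finset.Icc (-n : ℤ) n, (m : ℂ) ^ 2 • w m := by
  obtain ⟨w, rfl⟩ := (Submodule.mem_iSup_finset_iff_exists_sum _ _).mp hP
  refine ⟨fun m => w m, rfl, fun θ => ?_, ?_⟩
  · rw [map_sum]
    exact Finset.sum_congr rfl fun m _ => (w m).2.2 θ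
  · rw [map_sum, map_sum, ← Finset.sum_neg_distrib]
    refine Finset.sum_congr rfl fun m _ => ?_
    rw [(w m).2.1, Derivation.map_smul, (w m).2.1, smul_smul, ← neg_smul]
    congr 1
    linear_combination (m : ℂ) ^ 2 * Complex.I_sq

theorem angDeriv_angDeriv (j k : σ) (P : MvPolynomial σ ℂ) :
    angDeriv j k (angDeriv j k P) = X j ^ 2 * pderiv k (pderiv k P) + X k ^ 2 * pderiv j (pderiv j P)
      - X j * pderiv j P - X k * pderiv k P - X k * (X j * pderiv k (pderiv j P))
      - X j * (X k * pderiv j (pderiv k P)) + if j = k then 2 * (X j * pderiv j P) else 0 := by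
  simp only [angDeriv_apply, map_sub, pderiv_mul, pderiv_X_self]
  split_ifs with h
  · subst h
    simp only [pderiv_X_self]
    ring
  · rw [pderiv_X_of_ne h, pderiv_X_of_ne (Ne.symm h)]
    ring

/-- With `E` the Euler operator and `n` variables, the sum over ordered pairs is `2 (|x| ^ 2 Δ - E ^
2 - (n - 2) E)`. Harmonicity removes the first term and Euler's identity evaluates the others. -/
theorem sum_angDeriv_sq [Fintype σ] {P : MvPolynomial σ ℂ} {l : ℕ} (hP : P.IsHomogeneous l)
    (hL : ∑ i, pderiv i (pderiv i P) = 0) :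
    ∑ j, ∑ k, angDeriv j k (angDeriv j k P) =
      (-(2 * (l : ℂ) * (l + (Fintype.card σ - 2)))) • P := by
  have hE : ∑ i, X i * pderiv i P = (l : MvPolynomial σ ℂ) * P := by
    rw [hP.sum_X_mul_pderiv, nsmul_eq_mul]
  have hE2 : ∀ k, ∑ j, X j * pderiv k (pderiv j P) = ((l : MvPolynomial σ ℂ) - 1) * pderiv k P := by
    intro k
    have := congrArg (pderiv k) hE
    simp only [map_sum, pderiv_mul, Finset.sum_add_distrib, Derivation.map_natCast, zero_mul,
      zero_add] at this
    rw [Finset.sum_eq_single k (fun j _ hj => by rw [pderiv_X_of_ne hj, zero_mul]) (by simp),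
      pderiv_X_self] at this
    linear_combination this
  simp only [angDeriv_angDeriv, Finset.sum_add_distrib, Finset.sum_sub_distrib, ← Finset.mul_sum,
    ← Finset.sum_mul, hL, Finset.sum_const, Finset.card_univ, Finset.sum_ite_eq, Finset.mem_univ,
    if_true, mul_zero, hE, Finset.sum_comm (f := fun j k => X k * (X j * pderiv k (pderiv j P))),
    hE2]
  have e : ∀ (n : MvPolynomial σ ℂ) k, X k * (n * pderiv k P) = n * (X k * pderiv k P) :=
    fun n k => by ring
  simp only [nsmul_eq_mul, e, ← Finset.mul_sum, hE, smul_eq_C_mul, map_neg, map_mul, map_add,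
    map_sub, map_natCast, map_ofNat]
  ring

end Polynomials

/-! ### Rotation invariance of the surface measure and of the `L^p` norm -/

section Measure

open MeasureTheory

open scoped Pointwise

/-- The action of a linear isometry on the unit sphere. -/
def sphMap {d : ℕ} (R : Ambient d ≃ₗᵢ[ℝ] Ambient d) (ω : Sph d) : Sph d :=
  ⟨R ω, by simp⟩

theorem continuous_sphMap {d : ℕ} (R : Ambient d ≃ₗᵢ[ℝ] Ambient d) : Continuous (sphMap R) :=
  (R.continuous.comp continuous_subtype_val).subtype_mk _

theorem measurePreserving_sphMap {d : ℕ} (R : Ambient d ≃ₗᵢ[ℝ] Ambient d) :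
    MeasurePreserving (sphMap R) (surfaceMeasure d) (surfaceMeasure d) := by
  refine ⟨(continuous_sphMap R).measurable, Measure.ext fun s hs => ?_⟩
  rw [Measure.map_apply (continuous_sphMap R).measurable hs, surfaceMeasure,
    Measure.toSphere_apply' _ hs,
    Measure.toSphere_apply' _ ((continuous_sphMap R).measurable hs)]
  congr 1
  -- The surface measure is a multiple of the volume of the cone over a set, and cones commute with
  -- linear isometries.
  have e : Set.Ioo (0 : ℝ) 1 • ((↑) '' (sphMap R ⁻¹' s) : Set (Ambient d)) =
      R ⁻¹' (Set.Ioo (0 : ℝ) 1 • ((↑) '' s)) := by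
    ext x
    simp only [Set.mem_smul, Set.mem_image, Set.mem_preimage]
    constructor
    · rintro ⟨c, hc, _, ⟨ω, hω, rfl⟩, rfl⟩
      exact ⟨c, hc, R ω, ⟨_, hω, rfl⟩, by simp⟩
    · rintro ⟨c, hc, _, ⟨ω, hω, rfl⟩, h⟩
      have hω' : sphMap R (sphMap R.symm ω) = ω := Subtype.ext (by simp [sphMap])
      refine ⟨c, hc, R.symm ω, ⟨sphMap R.symm ω, by rwa [hω'], rfl⟩, ?_⟩
      apply R.injective
      rw [← h]
      simp
  rw [e]
  exact R.measurePreserving.measure_preimage_emb R.toHomeomorph.measurableEmbedding _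

theorem continuous_evalReal {d : ℕ} (P : MvPolynomial (Fin (d + 1)) ℂ) :
    Continuous (evalReal P) := by
  unfold evalReal
  apply P.continuous_eval.comp
  fun_prop

/-- The coordinate function of the rotation of angle `θ` in the plane of the coordinates `j` and
`k`. -/
def rotFun {d : ℕ} (j k : Fin (d + 1)) (θ : ℝ) (x : Ambient d) : Ambient d :=
  WithLp.toLp 2 fun i => if i = j then Real.cos θ * x j - Real.sin θ * x k
    else if i = k then Real.sin θ * x j + Real.cos θ * x k else x i

/-- The rotation of angle `θ` in the plane of the coordinates `j` and `k`. -/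
def rotation {d : ℕ} {j k : Fin (d + 1)} (h : j ≠ k) (θ : ℝ) : Ambient d ≃ₗᵢ[ℝ] Ambient d :=
  LinearIsometry.toLinearIsometryEquiv
    { toFun := rotFun j k θ
      map_add' := fun x y => by
        ext i
        simp only [rotFun, PiLp.add_apply]
        split_ifs <;> ring
      map_smul' := fun c x => by
        ext i
        simp only [rotFun, PiLp.smul_apply, smul_eq_mul, RingHom.id_apply]
        split_ifs <;> ring
      norm_map' := fun x => by
        have key : ∀ f : Fin (d + 1) → ℝ, ∑ i, f i =
            f j + (f k + ∑ i ∈ (Finset.univ.erase j).erase k, f i) := fun f => by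
          rw [Finset.add_sum_erase _ _ (by simp [h.symm]), Finset.add_sum_erase _ _ (by simp)]
        rw [← sq_eq_sq₀ (norm_nonneg _) (norm_nonneg _), EuclideanSpace.real_norm_sq_eq,
          EuclideanSpace.real_norm_sq_eq, key, key]
        have : ∑ i ∈ (Finset.univ.erase j).erase k, (rotFun j k θ x) i ^ 2 =
            ∑ i ∈ (Finset.univ.erase j).erase k, x i ^ 2 :=
          Finset.sum_congr rfl fun i hi => by
            simp only [Finset.mem_erase] at hi
            simp [rotFun, hi.1, hi.2.1]
        change (rotFun j k θ x) j ^ 2 + ((rotFun j k θ x) k ^ 2 + _) = _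
        erw [this]
        simp only [rotFun, if_true, h.symm, if_false]
        linear_combination (x j ^ 2 + x k ^ 2) * Real.sin_sq_add_cos_sq θ } rfl

theorem evalReal_rotHom {d : ℕ} {j k : Fin (d + 1)} (h : j ≠ k) (θ : ℝ)
    (P : MvPolynomial (Fin (d + 1)) ℂ) (x : Ambient d) :
    evalReal (rotHom j k θ P) x = evalReal P (rotation h θ x) := by
  have e : ((MvPolynomial.aeval (R := ℂ) fun i => ((x i : ℝ) : ℂ)).comp (rotHom j k θ)) =
      MvPolynomial.aeval fun i => ((rotation h θ x i : ℝ) : ℂ) := by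
    apply MvPolynomial.algHom_ext
    intro i
    have : rotation h θ x i = if i = j then Real.cos θ * x j - Real.sin θ * x k
      else if i = k then Real.sin θ * x j + Real.cos θ * x k else x i := rfl
    simp only [rotHom, AlgHom.comp_apply, MvPolynomial.aeval_X, this]
    split_ifs <;> simp
  have := DFunLike.congr_fun e P
  simpa [evalReal, MvPolynomial.aeval_eq_eval] using this

variable (p : ℝ≥0∞)

theorem normSphereRadius_eq {d : ℕ} {r : ℝ} (hr : 0 < r) (P : MvPolynomial (Fin (d + 1)) ℂ) :
    normSphereRadius p r (evalReal P) = ENNReal.ofReal (r ^ d) ^ (1 / p).toReal *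
      normSphere p (fun ω : Sph d => evalReal P (r • (ω : Ambient d))) := by
  rw [normSphereRadius, surfaceMeasureRadius,
    eLpNorm_smul_measure_of_ne_zero (by simpa using pow_pos hr d), smul_eq_mul,
    eLpNorm_map_measure (continuous_evalReal P).aestronglyMeasurable]
  · rfl
  · exact (Continuous.measurable (by fun_prop)).aemeasurable

variable [Fact (1 ≤ p)]

instance isFiniteMeasure_surfaceMeasure (d : ℕ) : IsFiniteMeasure (surfaceMeasure d) := by
  unfold surfaceMeasure
  infer_instance

/-- The restriction of polynomials to the unit sphere, as a continuous function. -/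
def restrictCont (d : ℕ) : MvPolynomial (Fin (d + 1)) ℂ →ₗ[ℂ] C(Sph d, ℂ) where
  toFun P := ⟨restrictSphere d P, (continuous_evalReal P).comp continuous_subtype_val⟩
  map_add' P R := ContinuousMap.ext fun ω => congrFun (map_add (restrictSphere d) P R) ω
  map_smul' c P := ContinuousMap.ext fun ω => congrFun (map_smul (restrictSphere d) c P) ω

/-- The restriction of polynomials to the unit sphere, as an element of `L^p`. -/
def toLpSphere (d : ℕ) : MvPolynomial (Fin (d + 1)) ℂ →ₗ[ℂ] Lp ℂ p (surfaceMeasure d) :=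
  (ContinuousMap.toLp p (surfaceMeasure d) ℂ).toLinearMap ∘ₗ restrictCont d

theorem ofReal_norm_toLpSphere {d : ℕ} (P : MvPolynomial (Fin (d + 1)) ℂ) :
    ENNReal.ofReal ‖toLpSphere p d P‖ = normSphere p (restrictSphere d P) := by
  rw [Lp.norm_def, ENNReal.ofReal_toReal (Lp.eLpNorm_ne_top _)]
  exact eLpNorm_congr_ae (ContinuousMap.coeFn_toLp (surfaceMeasure d) (restrictCont d P))

theorem norm_toLpSphere {d : ℕ} (P : MvPolynomial (Fin (d + 1)) ℂ) :
    ‖toLpSphere p d P‖ = (normSphere p (restrictSphere d P)).toReal := by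
  rw [← ofReal_norm_toLpSphere, ENNReal.toReal_ofReal (norm_nonneg _)]

theorem norm_toLpSphere_rotHom {d : ℕ} {j k : Fin (d + 1)} (h : j ≠ k) (θ : ℝ)
    (P : MvPolynomial (Fin (d + 1)) ℂ) :
    ‖toLpSphere p d (rotHom j k θ P)‖ = ‖toLpSphere p d P‖ := by
  have e : restrictSphere d (rotHom j k θ P) =
      restrictSphere d P ∘ sphMap (rotation h θ) := by
    ext ω
    exact evalReal_rotHom h θ P ω
  rw [norm_toLpSphere, norm_toLpSphere, e, normSphere, normSphere,
    eLpNorm_comp_measurePreserving _ (measurePreserving_sphMap _)]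
  exact ((continuous_evalReal P).comp continuous_subtype_val).aestronglyMeasurable

end Measure

/-! ### Norms of dilations of harmonic polynomials -/

section Dilation

open MvPolynomial

theorem evalReal_smul_of_isHomogeneous {d l : ℕ} {P : MvPolynomial (Fin (d + 1)) ℂ}
    (hP : P.IsHomogeneous l) (r : ℝ) (x : Ambient d) :
    evalReal P (r • x) = (r : ℂ) ^ l * evalReal P x := by
  simp only [evalReal, eval_eq, Finset.mul_sum]
  refine Finset.sum_congr rfl fun s hs => ?_
  have hdeg : ∑ i ∈ s.support, s i = l := by
    have := hP (mem_support_iff.mp hs)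
    rwa [Pi.one_def, ← Finsupp.degree_eq_weight_one] at this
  simp only [PiLp.smul_apply, smul_eq_mul, Complex.ofReal_mul, mul_pow, Finset.prod_mul_distrib,
    Finset.prod_pow_eq_pow_sum, hdeg]
  ring

variable (p : ℝ≥0∞) [Fact (1 ≤ p)] {d : ℕ}

theorem norm_trigSum_toLpSphere {j k : Fin (d + 1)} (h : j ≠ k) {n : ℕ}
    {P : MvPolynomial (Fin (d + 1)) ℂ} {w : ℤ → MvPolynomial (Fin (d + 1)) ℂ}
    (hw : ∑ m ∈ Finset.Icc (-n : ℤ) n, w m = P)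
    (hrot : ∀ θ : ℝ, rotHom j k θ P =
        ∑ m ∈ Finset.Icc (-n : ℤ) n, Complex.exp (Complex.I * m * θ) • w m) (θ : ℝ) :
    ‖trigSum (Finset.Icc (-n : ℤ) n) (fun m => toLpSphere p d (w m)) θ‖ =
      ‖∑ m ∈ Finset.Icc (-n : ℤ) n, toLpSphere p d (w m)‖ := by
  rw [← map_sum, hw, ← norm_toLpSphere_rotHom p h θ P, hrot, map_sum]
  simp only [trigSum, map_smul]

theorem angDeriv_self (j : Fin (d + 1)) (P : MvPolynomial (Fin (d + 1)) ℂ) :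
    angDeriv j j P = 0 := by
  rw [angDeriv_apply, sub_self]

theorem norm_toLpSphere_angDeriv_sq_le {L : ℕ} (hL : 1 ≤ L) {P : MvPolynomial (Fin (d + 1)) ℂ}
    (hP : ∀ j k : Fin (d + 1), j ≠ k → P ∈ weightSum j k L) (j k : Fin (d + 1)) :
    ‖toLpSphere p d (angDeriv j k (angDeriv j k P))‖ ≤ (L : ℝ) ^ 2 * ‖toLpSphere p d P‖ := by
  rcases eq_or_ne j k with rfl | h
  · rw [angDeriv_self, map_zero, norm_zero]
    positivity
  · obtain ⟨w, hw, hrot, hD⟩ := exists_weight_decomposition (hP j k h)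
    have := norm_sum_sq_smul_le hL (s := Finset.Icc (-L : ℤ) L)
      (fun m hm => abs_le.mpr (Finset.mem_Icc.mp hm)) (norm_trigSum_toLpSphere p h hw hrot)
    rw [hD, map_neg, norm_neg, map_sum]
    simp only [map_smul]
    rwa [← map_sum, hw] at this

theorem re_apply_angDeriv_sq_nonpos {L : ℕ} {P : MvPolynomial (Fin (d + 1)) ℂ}
    (hP : ∀ j k : Fin (d + 1), j ≠ k → P ∈ weightSum j k L)
    {g : StrongDual ℂ (MeasureTheory.Lp ℂ p (surfaceMeasure d))} (hg : ‖g‖ ≤ 1)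
    (hgP : g (toLpSphere p d P) = ‖toLpSphere p d P‖) (j k : Fin (d + 1)) :
    (g (toLpSphere p d (angDeriv j k (angDeriv j k P)))).re ≤ 0 := by
  rcases eq_or_ne j k with rfl | h
  · rw [angDeriv_self, map_zero, map_zero, Complex.zero_re]
  · obtain ⟨w, hw, hrot, hD⟩ := exists_weight_decomposition (hP j k h)
    have := re_apply_sum_sq_smul_nonneg (s := Finset.Icc (-L : ℤ) L)
      (norm_trigSum_toLpSphere p h hw hrot) hg (by rw [← map_sum, hw, hgP])
    rw [hD, map_neg, map_neg, Complex.neg_re, map_sum]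
    simp only [map_smul] at this ⊢
    linarith

/-- The combination of the polynomials `Y l` with real coefficients `a l`. -/
def polySum (s : Finset ℕ) (Y : ℕ → MvPolynomial (Fin (d + 1)) ℂ) (a : ℕ → ℝ) :
    MvPolynomial (Fin (d + 1)) ℂ := ∑ l ∈ s, (a l : ℂ) • Y l

theorem multSum_toLpSphere (s : Finset ℕ) (Y : ℕ → MvPolynomial (Fin (d + 1)) ℂ) (a : ℕ → ℝ) :
    multSum s (fun l => toLpSphere p d (Y l)) a = toLpSphere p d (polySum s Y a) := by
  simp only [multSum, polySum, map_sum, map_smul]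

variable {L : ℕ} {Y : ℕ → MvPolynomial (Fin (d + 1)) ℂ}

theorem sum_angDeriv_sq_polySum {s : Finset ℕ} (hY : ∀ l, Y l ∈ solidHarmonics d l) (a : ℕ → ℝ) :
    ∑ j, ∑ k, angDeriv j k (angDeriv j k (polySum s Y a)) =
      (-2 : ℂ) • polySum s Y fun l => lapEig (d - 1) l * a l := by
  have h : ∀ l, ∑ j, ∑ k, angDeriv j k (angDeriv j k (Y l)) =
      (-(2 * (l : ℂ) * (l + ((d : ℂ) - 1)))) • Y l := fun l => by
    rw [sum_angDeriv_sq ((mem_homogeneousSubmodule _ _).mp (hY l).1) ?_]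
    · congr 4
      rw [Fintype.card_fin]
      push_cast
      ring
    · simpa [polyLaplacian] using (hY l).2
  simp only [polySum, map_sum, Derivation.map_smul, Finset.smul_sum]
  simp_rw [Finset.sum_comm (t := s)]
  refine Finset.sum_congr rfl fun l _ => ?_
  simp only [← Finset.smul_sum, h, smul_smul, lapEig]
  congr 1
  push_cast
  ring

theorem polySum_mem_weightSum (hY : ∀ l, Y l ∈ solidHarmonics d l) (a : ℕ → ℝ)
    (j k : Fin (d + 1)) (h : j ≠ k) : polySum (Finset.range (L + 1)) Y a ∈ weightSum j k L :=
  Submodule.sum_mem _ fun l hl => Submodule.smul_mem _ _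
    (weightSum_mono (Nat.lt_succ_iff.mp (Finset.mem_range.mp hl))
      (homogeneousSubmodule_le_weightSum h l (hY l).1))

theorem re_apply_lapEig_nonneg (hY : ∀ l, Y l ∈ solidHarmonics d l) (a : ℕ → ℝ)
    (g : StrongDual ℂ (MeasureTheory.Lp ℂ p (surfaceMeasure d))) (hg : ‖g‖ ≤ 1)
    (hga : g (multSum (Finset.range (L + 1)) (fun l => toLpSphere p d (Y l)) a) =
      ‖multSum (Finset.range (L + 1)) (fun l => toLpSphere p d (Y l)) a‖) :
    0 ≤ (g (multSum (Finset.range (L + 1)) (fun l => toLpSphere p d (Y l))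
      fun l => lapEig (d - 1) l * a l)).re := by
  rw [multSum_toLpSphere] at hga ⊢
  have h := Finset.sum_nonpos fun j (_ : j ∈ Finset.univ) =>
    Finset.sum_nonpos fun k (_ : k ∈ Finset.univ) =>
      re_apply_angDeriv_sq_nonpos p (polySum_mem_weightSum hY a) hg hga j k
  simp only [← Complex.re_sum, ← map_sum] at h
  rw [sum_angDeriv_sq_polySum hY, map_smul, map_smul, smul_eq_mul] at h
  simp at h
  exact h

theorem norm_lapEig_le (hL : 1 ≤ L) (hY : ∀ l, Y l ∈ solidHarmonics d l) (a : ℕ → ℝ) :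
    ‖multSum (Finset.range (L + 1)) (fun l => toLpSphere p d (Y l))
      fun l => lapEig (d - 1) l * a l‖ ≤
    ((d + 1) * L) ^ 2 * ‖multSum (Finset.range (L + 1)) (fun l => toLpSphere p d (Y l)) a‖ := by
  rw [multSum_toLpSphere, multSum_toLpSphere]
  have h : ‖toLpSphere p d (∑ j, ∑ k,
      angDeriv j k (angDeriv j k (polySum (Finset.range (L + 1)) Y a)))‖ ≤
      ((d + 1) * L) ^ 2 * ‖toLpSphere p d (polySum (Finset.range (L + 1)) Y a)‖ := by
    simp only [map_sum]
    refine (norm_sum_le_of_le _ fun j _ => norm_sum_le_of_le _ fun k _ =>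
      norm_toLpSphere_angDeriv_sq_le p hL (polySum_mem_weightSum hY a) j k).trans_eq ?_
    simp only [Finset.sum_const, Finset.card_univ, Fintype.card_fin, nsmul_eq_mul]
    push_cast
    ring
  -- The factor 2 from ordered pairs is not exploited; a bound of order `L ^ 2` is all that matters.
  rw [sum_angDeriv_sq_polySum hY, map_smul, norm_smul] at h
  norm_num at h
  linarith [norm_nonneg (toLpSphere p d
    (polySum (Finset.range (L + 1)) Y fun l => lapEig (d - 1) l * a l))]

theorem norm_toLpSphere_dilation_le (hd : 1 ≤ d) (hY : ∀ l, Y l ∈ solidHarmonics d l) {r : ℝ}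
    (hr : 0 < r) (hr1 : r ≤ 1) :
    ‖toLpSphere p d (polySum (Finset.range (L + 1)) Y fun l => r ^ l)‖ ≤
      ‖toLpSphere p d (polySum (Finset.range (L + 1)) Y fun _ => 1)‖ := by
  have hd' : (0 : ℝ) ≤ d - 1 := by
    rw [sub_nonneg]
    exact_mod_cast hd
  have := norm_multSum_exp_le hd' (re_apply_lapEig_nonneg p (L := L) hY)
    (Real.log_nonpos hr.le hr1)
  simpa only [multSum_toLpSphere, Real.exp_nat_mul, Real.exp_log hr] using this

/-- The norm of the dilation by a factor at most `1 + ρ / L`. -/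
def dilationBound (d : ℕ) (ρ : ℝ) : ℝ :=
  2 * Real.cosh (ρ * √(((d : ℝ) + 1) ^ 2 + ((d : ℝ) - 1) ^ 2 / 4)) + 1

theorem one_le_dilationBound (d : ℕ) (ρ : ℝ) : 1 ≤ dilationBound d ρ := by
  have := Real.cosh_pos (ρ * √(((d : ℝ) + 1) ^ 2 + ((d : ℝ) - 1) ^ 2 / 4))
  rw [dilationBound]
  linarith

theorem norm_toLpSphere_dilation_le_bound (hd : 1 ≤ d) (hL : 1 ≤ L)
    (hY : ∀ l, Y l ∈ solidHarmonics d l) {r ρ : ℝ} (hr : 0 < r) (hrρ : r - 1 ≤ ρ / L) :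
    ‖toLpSphere p d (polySum (Finset.range (L + 1)) Y fun l => r ^ l)‖ ≤ dilationBound d ρ *
      ‖toLpSphere p d (polySum (Finset.range (L + 1)) Y fun _ => 1)‖ := by
  have hL' : (1 : ℝ) ≤ L := by exact_mod_cast hL
  rcases le_total r 1 with hr1 | hr1
  · exact (norm_toLpSphere_dilation_le p hd hY hr hr1).trans
      (le_mul_of_one_le_left (norm_nonneg _) (one_le_dilationBound d ρ))
  have hd' : (0 : ℝ) ≤ d - 1 := by
    rw [sub_nonneg]
    exact_mod_cast hd
  have hlog := Real.log_nonneg hr1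
  have h := norm_multSum_exp_le_cosh hd' (by positivity) (re_apply_lapEig_nonneg p (L := L) hY)
    (norm_lapEig_le p hL hY) hlog
  simp only [multSum_toLpSphere, Real.exp_nat_mul, Real.exp_log hr] at h
  refine h.trans ?_
  rw [dilationBound]
  gcongr
  rw [Real.cosh_le_cosh, abs_of_nonneg (by positivity)]
  refine le_trans ?_ (le_abs_self _)
  have h1 : Real.log r * L ≤ ρ := by
    rw [← le_div_iff₀ (by linarith)]
    linarith [Real.log_le_sub_one_of_pos hr]
  -- Since `L ≥ 1`, a full factor `L` comes out of the root and cancels against `log r ≤ r - 1 ≤ ρ /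
  -- L`, leaving a bound free of `L`.
  have h2 : √(((d + 1) * L) ^ 2 + ((d : ℝ) - 1) ^ 2 / 4) ≤
      L * √(((d : ℝ) + 1) ^ 2 + ((d : ℝ) - 1) ^ 2 / 4) := by
    rw [← Real.sqrt_sq (show (0 : ℝ) ≤ L by linarith), ← Real.sqrt_mul (by positivity),
      Real.sqrt_sq (show (0 : ℝ) ≤ L by linarith)]
    apply Real.sqrt_le_sqrt
    have : (1 : ℝ) ≤ L ^ 2 := one_le_pow₀ hL'
    nlinarith [sq_nonneg ((d : ℝ) - 1)]
  calc _ ≤ Real.log r * (L * √(((d : ℝ) + 1) ^ 2 + ((d : ℝ) - 1) ^ 2 / 4)) := by gcongr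
    _ = (Real.log r * L) * √(((d : ℝ) + 1) ^ 2 + ((d : ℝ) - 1) ^ 2 / 4) := by ring
    _ ≤ _ := by gcongr

/-- Dilation by `1 / r` undoes dilation by `r`: the upper bound is applied to the components `r ^ l
Y_l`. -/
theorem norm_toLpSphere_le_dilation (hd : 1 ≤ d) (hL : 1 ≤ L)
    (hY : ∀ l, Y l ∈ solidHarmonics d l) {r ρ : ℝ} (hr : 0 < r) (hrρ : r⁻¹ - 1 ≤ ρ / L) :
    ‖toLpSphere p d (polySum (Finset.range (L + 1)) Y fun _ => 1)‖ ≤ dilationBound d ρ *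
      ‖toLpSphere p d (polySum (Finset.range (L + 1)) Y fun l => r ^ l)‖ := by
  have h := norm_toLpSphere_dilation_le_bound p hd hL (Y := fun l => ((r ^ l : ℝ) : ℂ) • Y l)
    (fun l => Submodule.smul_mem _ _ (hY l)) (inv_pos.mpr hr) hrρ
  have e : polySum (Finset.range (L + 1)) (fun l => ((r ^ l : ℝ) : ℂ) • Y l)
      (fun l => r⁻¹ ^ l) = polySum (Finset.range (L + 1)) Y fun _ => 1 := by
    simp only [polySum, smul_smul, ← Complex.ofReal_mul, ← mul_pow, inv_mul_cancel₀ hr.ne', one_pow]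
  have e' : polySum (Finset.range (L + 1)) (fun l => ((r ^ l : ℝ) : ℂ) • Y l)
      (fun _ => 1) = polySum (Finset.range (L + 1)) Y fun l => r ^ l := by
    simp only [polySum, Complex.ofReal_one, one_smul]
  rwa [e, e'] at h

theorem normSphereRadius_polySum (hY : ∀ l, Y l ∈ solidHarmonics d l) {s : Finset ℕ} {r : ℝ}
    (hr : 0 < r) :
    normSphereRadius p r (evalReal (polySum s Y fun _ => 1)) =
      ENNReal.ofReal ((r ^ d) ^ (1 / p).toReal * ‖toLpSphere p d (polySum s Y fun l => r ^ l)‖) := by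
  rw [normSphereRadius_eq p hr, ENNReal.ofReal_rpow_of_pos (pow_pos hr d),
    ENNReal.ofReal_mul (by positivity), ofReal_norm_toLpSphere]
  congr 2
  ext ω
  change _ = evalReal _ _
  have h := fun l => evalReal_smul_of_isHomogeneous
    ((mem_homogeneousSubmodule _ _).mp (hY l).1) r (ω : Ambient d)
  simp only [evalReal] at h
  simp only [polySum, evalReal, map_sum, smul_eval, h]
  push_cast
  simp

/-- Used with `e = 1 / p`, which is `0` for `p = ∞`, to bound the Jacobian factor independently of
`p`. -/
theorem rpow_le_of_le {x y e : ℝ} (hx : 0 ≤ x) (he : 0 ≤ e) (he1 : e ≤ 1) (hxy : x ≤ y)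
    (hy : 1 ≤ y) : x ^ e ≤ y :=
  (Real.rpow_le_rpow hx hxy he).trans
    ((Real.rpow_le_rpow_of_exponent_le hy he1).trans_eq (Real.rpow_one y))

theorem le_rpow_of_le {x y e : ℝ} (hy : 0 < y) (he : 0 ≤ e) (he1 : e ≤ 1) (hxy : y ≤ x)
    (hy1 : y ≤ 1) : y ≤ x ^ e :=
  ((Real.rpow_one y).symm.trans_le (Real.rpow_le_rpow_of_exponent_ge hy hy1 he1)).trans
    (Real.rpow_le_rpow hy.le hxy he)

end Dilation

end SphHarm

end

/-! ### The two inequalities and their constant -/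

theorem mainTheorem7 (d : ℕ) (hd : 1 ≤ d) (p : ℝ≥0∞) (hp : 1 ≤ p) (ρ : ℝ) (hρ : 0 < ρ) :
    ∃ C : ℝ, 0 < C ∧
      ∀ L : ℕ, 1 ≤ L →
        ∀ Q ∈ SphHarm.sphericalHarmonicsUpTo d L,
          ∀ P : MvPolynomial (Fin (d + 1)) ℂ, SphHarm.IsHarmonicExtension L Q P →
            ∀ r : ℝ, 0 < r → |r - 1| ≤ ρ / (L : ℝ) →
              SphHarm.normSphereRadius p r (SphHarm.evalReal P) ≤
                  ENNReal.ofReal C⁻¹ * SphHarm.normSphere p Q ∧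
              ((ρ < (L : ℝ) ∨ 1 ≤ r) →
                ENNReal.ofReal C * SphHarm.normSphere p Q ≤
                  SphHarm.normSphereRadius p r (SphHarm.evalReal P)) := by
  have : Fact (1 ≤ p) := ⟨hp⟩
  -- `N` is the least integer above `ρ`. Every integer `L > ρ` has `L ≥ N`, so `r ≥ 1 - ρ / L ≥ r₀ >
  -- 0` with `r₀` independent of `L`; for `r ≥ 1` the bound `r ≥ r₀` is trivial.
  set N : ℝ := ⌊ρ⌋₊ + 1 with hN
  have hN0 : 0 < N := by positivity
  have hρN : ρ < N := Nat.lt_floor_add_one ρ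
  set r₀ : ℝ := 1 - ρ / N with hr₀
  have hr₀1 : r₀ ≤ 1 := by
    have : 0 ≤ ρ / N := by positivity
    linarith
  have hr₀0 : 0 < r₀ := by
    have : ρ / N < 1 := (div_lt_one hN0).mpr hρN
    linarith
  set k₁ := (1 + ρ) ^ d * SphHarm.dilationBound d ρ with hk₁
  set k₂ := SphHarm.dilationBound d (ρ / r₀) with hk₂
  have hk₁0 : 0 < k₁ := mul_pos (by positivity)
    (zero_lt_one.trans_le (SphHarm.one_le_dilationBound d ρ))
  have hk₂0 : 0 < k₂ := zero_lt_one.trans_le (SphHarm.one_le_dilationBound d _)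
  have hC0 : 0 < min k₁⁻¹ (r₀ ^ d / k₂) := by positivity
  have he0 : 0 ≤ (1 / p).toReal := ENNReal.toReal_nonneg
  have he1 : (1 / p).toReal ≤ 1 := by
    refine ENNReal.toReal_le_of_le_ofReal zero_le_one ?_
    simpa using hp
  refine ⟨min k₁⁻¹ (r₀ ^ d / k₂), hC0, ?_⟩
  intro L hL Q _ P hP r hr hrL
  have hL' : (1 : ℝ) ≤ L := by exact_mod_cast hL
  obtain ⟨hPmem, rfl⟩ := hP
  obtain ⟨Y, hYP⟩ := (Submodule.mem_iSup_finset_iff_exists_sum _ _).mp hPmem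
  have hY : ∀ l, (Y l : MvPolynomial (Fin (d + 1)) ℂ) ∈ SphHarm.solidHarmonics d l :=
    fun l => (Y l).2
  have hP1 : P = SphHarm.polySum (Finset.range (L + 1))
      (fun l => (Y l : MvPolynomial (Fin (d + 1)) ℂ)) fun _ => 1 := by
    simp [SphHarm.polySum, hYP]
  rw [abs_le] at hrL
  rw [hP1, SphHarm.normSphereRadius_polySum p hY hr, ← SphHarm.ofReal_norm_toLpSphere,
    ← ENNReal.ofReal_mul (inv_pos.mpr hC0).le, ← ENNReal.ofReal_mul hC0.le]
  refine ⟨ENNReal.ofReal_le_ofReal ?_, fun hcase => ENNReal.ofReal_le_ofReal ?_⟩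
  · have hr2 : r ≤ 1 + ρ := by
      have : ρ / L ≤ ρ := div_le_self hρ.le hL'
      linarith
    have h1 : (r ^ d) ^ (1 / p).toReal ≤ (1 + ρ) ^ d :=
      SphHarm.rpow_le_of_le (by positivity) he0 he1 (pow_le_pow_left₀ hr.le hr2 d)
        (one_le_pow₀ (by linarith))
    have h2 := SphHarm.norm_toLpSphere_dilation_le_bound p hd hL hY hr hrL.2
    have h3 : k₁ ≤ (min k₁⁻¹ (r₀ ^ d / k₂))⁻¹ :=
      (le_inv_comm₀ hk₁0 hC0).mpr (min_le_left _ _)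
    calc _ ≤ (1 + ρ) ^ d * (SphHarm.dilationBound d ρ * _) :=
          mul_le_mul h1 h2 (norm_nonneg _) (by positivity)
      _ = k₁ * _ := by rw [hk₁, mul_assoc]
      _ ≤ _ := mul_le_mul_of_nonneg_right h3 (norm_nonneg _)
  · have hr₀r : r₀ ≤ r := by
      rcases hcase with h | h
      · have hNL : N ≤ L := by
          rw [hN]
          exact_mod_cast (Nat.floor_lt hρ.le).mpr h
        have : ρ / L ≤ ρ / N := by gcongr
        linarith
      · linarith
    -- The inverse dilation stays in a window of the same kind, with `ρ / r₀` in place of `ρ`; hence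
    -- the argument of `dilationBound` in `k₂`.
    have hinv : r⁻¹ - 1 ≤ ρ / r₀ / L := by
      have e : r⁻¹ - 1 = (1 - r) / r := by field_simp
      rw [e, div_right_comm]
      calc (1 - r) / r ≤ ρ / L / r := by
            gcongr
            linarith
        _ ≤ _ := by gcongr
    have h1 : r₀ ^ d ≤ (r ^ d) ^ (1 / p).toReal :=
      SphHarm.le_rpow_of_le (by positivity) he0 he1 (pow_le_pow_left₀ hr₀0.le hr₀r d)
        (pow_le_one₀ hr₀0.le hr₀1)
    have h2 := SphHarm.norm_toLpSphere_le_dilation p hd hL hY hr hinv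
    calc _ ≤ r₀ ^ d / k₂ * (k₂ * _) :=
          mul_le_mul (min_le_right _ _) h2 (norm_nonneg _) (by positivity)
      _ = r₀ ^ d * _ := by field_simp
      _ ≤ _ := mul_le_mul_of_nonneg_right h1 (norm_nonneg _)
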